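/- Let $E\neq\{0\}$ be a real Banach space with dual $E^*$, let $J(x)=\{j\in E^*:\langle x,j\rangle=\|x\|\|j\|,\ \|x\|=\|j\|\}$ be its normalized duality mapping, and let $$\rho_E(t)=\sup\{\tfrac12(\|x+y\|+\|x-y\|)-1:\ \|x\|=1,\ \|y\|\le t\}$$ be its modulus of smoothness. Assume that $E$ is $2$-uniformly smooth, i.e. that there is $c>0$ with $\rho_E(t)\le ct^2$ for all $t\ge 0$, and let $K$ be the best smooth constant of $E$, i.e. the smallest $K\ge0$ such that $$\|x+y\|^2\le\|x\|^2+2\langle y,j\rangle+2\|Ky\|^2\qquad\text{for all } x,y\in E,\ j\in J(x).$$ Let $C\subset E$ be closed and convex, let $\lambda\in(0,1)$, and let $T:C\to C$ be a $\lambda$-strict pseudocontraction, i.e. for all $x,y\in C$ there is $j\in J(x-y)$ with $$\langle Tx-Ty,j\rangle\le\|x-y\|^2-\lambda\|x-y-(Tx-Ty)\|^2 .$$ Assume that $F(T)=\{x\in C:Tx=x\}\neq\emptyset$. Let $u,x_0\in C$ and, for $n\ge0$, $$x_{n+1}=\beta_nu+(1-\beta_n)[\alpha_nTx_n+(1-\alpha_n)x_n],$$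 where the real numbers $\alpha_n$ and $\beta_n\in(0,1)$ satisfy (i) $\alpha_n\in[0,\mu]$ for all $n$, where $\mu=\min\{1,\lambda/K^2\}$, and $\liminf_{n\to\infty}\alpha_n(\lambda-K^2\alpha_n)>0$; (ii) $\lim_{n\to\infty}\beta_n=0$ and $\sum_{n=0}^\infty\beta_n=\infty$. Then $\{x_n\}$ converges strongly to a fixed point of $T$. -/

import Mathlib

open Filter Topology

noncomputable section

/-- The normalized duality mapping `J` from `E` into the subsets of its dual. -/
def normalizedDuality {E : Type*} [NormedAddCommGroup E] [NormedSpace ℝ E] (x : E) :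
    Set (E →L[ℝ] ℝ) :=
  {j | j x = ‖x‖ * ‖j‖ ∧ ‖x‖ = ‖j‖}

/-- The modulus of smoothness `ρ_E(t)`. -/
def modulusOfSmoothness (E : Type*) [NormedAddCommGroup E] [NormedSpace ℝ E] (t : ℝ) : ℝ :=
  sSup {r : ℝ | ∃ x y : E, ‖x‖ = 1 ∧ ‖y‖ ≤ t ∧ r = (1 / 2) * (‖x + y‖ + ‖x - y‖) - 1}

/-- `E` is `q`-uniformly smooth: `ρ_E(t) ≤ c t ^ q` for all `t ≥ 0` and some constant `c > 0`. -/
def IsQUniformlySmooth (E : Type*) [NormedAddCommGroup E] [NormedSpace ℝ E] (q : ℝ) : Prop :=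
  ∃ c : ℝ, 0 < c ∧ ∀ t : ℝ, 0 ≤ t → modulusOfSmoothness E t ≤ c * t ^ q

/-- The best smooth constant of `E`: the smallest `K ≥ 0` for which
`‖x + y‖² ≤ ‖x‖² + 2 ⟨y, J x⟩ + 2 ‖K y‖²` holds for all `x`, `y`
(the admissible constants form a closed set, and a nonempty one if `E` is 2-uniformly smooth). -/
def bestSmoothConst (E : Type*) [NormedAddCommGroup E] [NormedSpace ℝ E] : ℝ :=
  sInf {K : ℝ | 0 ≤ K ∧ ∀ x y : E, ∀ j ∈ normalizedDuality x,
    ‖x + y‖ ^ 2 ≤ ‖x‖ ^ 2 + 2 * j y + 2 * ‖K • y‖ ^ 2}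

/-- `T` is a `lam`-strict pseudocontraction on `C`. -/
def IsStrictPseudocontractionOn {E : Type*} [NormedAddCommGroup E] [NormedSpace ℝ E]
    (lam : ℝ) (T : E → E) (C : Set E) : Prop :=
  ∀ x ∈ C, ∀ y ∈ C, ∃ j ∈ normalizedDuality (x - y),
    j (T x - T y) ≤ ‖x - y‖ ^ 2 - lam * ‖x - y - (T x - T y)‖ ^ 2

end

/-! ### The duality mapping of a 2-uniformly smooth space -/

section Duality

variable {E : Type*} [NormedAddCommGroup E] [NormedSpace ℝ E]

/-! Write A = I - T and k = K². The smoothness inequality makes J single-valued and Lipschitz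
(`normalizedDuality_lipschitz`). Hence strict pseudocontractivity becomes cocoercivity of A against
J(x - y), and the smoothness inequality with increment -a(Ax - Ay) shows that x ↦ x - aAx is
nonexpansive for ka ≤ λ, with a gain 2a(λ - ka)‖Ax - Ay‖² in the squared distance
(`norm_relaxed_sub_sq_le`).

The limit q comes from the anchored resolvents Az = τ(u - z), obtained by contraction. Smoothness
forces reflexivity (`inclusionInDoubleDual_surjective`), so the asymptotic radius of the resolvents
as τ → 0 has a minimizer over C. Among the minimizers, the one nearest to a known fixed point is
itself fixed, and moving it towards u shows that the minimal radius is 0. Thus some resolvents come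
arbitrarily close to q (`exists_fixedPoint_near_resolvents`).

For the iteration, cocoercivity between x_n and one such resolvent bounds ⟨u - q, J(x_{n+1} - q)⟩ by
a multiple of the residual ‖Ax_n‖ plus small terms (`normalizedDuality_anchor_le`). The gain in the
squared distance absorbs the residual, leaving a scalar recursion that forces ‖x_n - q‖ → 0
(`halpern_tendsto`). -/

theorem normalizedDuality_nonempty (x : E) : (normalizedDuality x).Nonempty := by
  rcases subsingleton_or_nontrivial E with h | h
  · refine ⟨0, ?_, ?_⟩
    · simp
    · simp [Subsingleton.elim x 0]
  · obtain ⟨g, hg, hgx⟩ := exists_dual_vector' ℝ x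
    refine ⟨‖x‖ • g, ?_, ?_⟩
    · simp only [norm_smul, hg, norm_norm, mul_one, smul_apply, smul_eq_mul]
      rw [hgx]; rfl
    · simp [norm_smul, hg]

theorem normalizedDuality_apply_self {x : E} {j : E →L[ℝ] ℝ} (hj : j ∈ normalizedDuality x) :
    j x = ‖x‖ ^ 2 := by
  rw [hj.1, ← hj.2, sq]

theorem normalizedDuality_apply_le {x : E} {j : E →L[ℝ] ℝ} (hj : j ∈ normalizedDuality x)
    (y : E) : j y ≤ ‖x‖ * ‖y‖ := by
  rw [hj.2]
  exact (le_abs_self _).trans (j.le_opNorm y)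

theorem normalizedDuality_neg_le {x : E} {j : E →L[ℝ] ℝ} (hj : j ∈ normalizedDuality x)
    (y : E) : -(‖x‖ * ‖y‖) ≤ j y := by
  have := normalizedDuality_apply_le hj (-y)
  rw [map_neg, norm_neg] at this
  linarith

theorem normalizedDuality_smul {x : E} {j : E →L[ℝ] ℝ} (hj : j ∈ normalizedDuality x)
    {a : ℝ} (ha : 0 ≤ a) : a • j ∈ normalizedDuality (a • x) := by
  refine ⟨?_, ?_⟩
  · simp only [map_smul, smul_apply, smul_eq_mul, norm_smul, hj.1,
      Real.norm_eq_abs, abs_of_nonneg ha]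
    ring
  · simp [norm_smul, hj.2]

/-- Elements of `J x` are subgradients at `x` of half the squared norm. -/
theorem normalizedDuality_subgradient {x : E} {j : E →L[ℝ] ℝ} (hj : j ∈ normalizedDuality x)
    (y : E) : ‖x‖ ^ 2 + 2 * j (y - x) ≤ ‖y‖ ^ 2 := by
  have h1 := normalizedDuality_apply_le hj y
  have h2 := normalizedDuality_apply_self hj
  rw [map_sub]
  nlinarith [sq_nonneg (‖x‖ - ‖y‖)]

omit [NormedSpace ℝ E] in
theorem bddAbove_modulus_set (t : ℝ) :
    BddAbove {r : ℝ | ∃ x y : E, ‖x‖ = 1 ∧ ‖y‖ ≤ t ∧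
      r = (1 / 2) * (‖x + y‖ + ‖x - y‖) - 1} := by
  refine ⟨t, ?_⟩
  rintro r ⟨x, y, hx, hy, rfl⟩
  linarith [norm_add_le x y, norm_sub_le x y]

theorem norm_add_add_norm_sub_le_modulus {x y : E} (hx : ‖x‖ = 1) :
    ‖x + y‖ + ‖x - y‖ ≤ 2 + 2 * modulusOfSmoothness E ‖y‖ := by
  have := le_csSup (bddAbove_modulus_set (E := E) ‖y‖) ⟨x, y, hx, le_rfl, rfl⟩
  change _ ≤ modulusOfSmoothness E ‖y‖ at this
  linarith

/-- Combining the modulus bound with ‖x - y‖ ≥ 1 - j y gives ‖x + y‖ ≤ 1 + j y + 2c‖y‖². For ‖y‖ ≤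
1, squaring gives the coefficient 1 + 8c + 4c². For ‖y‖ ≥ 1 the triangle inequality suffices, and
replacing 2‖y‖ by 2 j y costs at most 4‖y‖, whence the 5. -/
theorem norm_add_sq_le_of_norm_eq_one {c : ℝ} (hc : 0 < c)
    (h : ∀ t : ℝ, 0 ≤ t → modulusOfSmoothness E t ≤ c * t ^ (2 : ℝ))
    {x : E} (hx : ‖x‖ = 1) (y : E) {j : E →L[ℝ] ℝ} (hj : j ∈ normalizedDuality x) :
    ‖x + y‖ ^ 2 ≤ 1 + 2 * j y + (5 + 8 * c + 4 * c ^ 2) * ‖y‖ ^ 2 := by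
  have h1 := norm_add_add_norm_sub_le_modulus (y := y) hx
  have h2 := h ‖y‖ (norm_nonneg y)
  rw [Real.rpow_two] at h2
  have h3 : 1 - j y ≤ ‖x - y‖ := by
    have := normalizedDuality_apply_le hj (x - y)
    rw [map_sub, normalizedDuality_apply_self hj, hx] at this
    linarith
  have h4 := normalizedDuality_apply_le hj y
  have h5 := normalizedDuality_neg_le hj y
  rw [hx, one_mul] at h4 h5
  have h6 := norm_add_le x y
  rw [hx] at h6
  have hs := norm_nonneg y
  have hxy := norm_nonneg (x + y)
  set s := ‖y‖
  set b := j y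
  rcases le_total s 1 with hs1 | hs1
  · have h7 : ‖x + y‖ ≤ 1 + b + 2 * c * s ^ 2 := by linarith
    have h8 : ‖x + y‖ ^ 2 ≤ (1 + b + 2 * c * s ^ 2) ^ 2 := by gcongr
    have h9 : b ^ 2 ≤ s ^ 2 := sq_le_sq' h5 h4
    have h10 : c * s ^ 2 * b ≤ c * s ^ 2 := by
      have : 0 ≤ c * s ^ 2 := by positivity
      nlinarith
    have h11 : c ^ 2 * s ^ 2 * s ^ 2 ≤ c ^ 2 * s ^ 2 := by
      have : s ^ 2 ≤ 1 := pow_le_one₀ hs hs1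
      have h' : 0 ≤ c ^ 2 * s ^ 2 := by positivity
      nlinarith
    nlinarith [sq_nonneg s]
  · have h8 : ‖x + y‖ ^ 2 ≤ (1 + s) ^ 2 := by gcongr
    have h9 : s ≤ s ^ 2 := by nlinarith
    have h10 : 0 ≤ (8 * c + 4 * c ^ 2) * s ^ 2 := by positivity
    nlinarith

theorem exists_smoothConst (hE : IsQUniformlySmooth E 2) :
    {K : ℝ | 0 ≤ K ∧ ∀ x y : E, ∀ j ∈ normalizedDuality x,
      ‖x + y‖ ^ 2 ≤ ‖x‖ ^ 2 + 2 * j y + 2 * ‖K • y‖ ^ 2}.Nonempty := by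
  obtain ⟨c, hc, h⟩ := hE
  set D := 5 + 8 * c + 4 * c ^ 2 with hD
  have hD5 : 5 ≤ D := by nlinarith [sq_nonneg c]
  refine ⟨√D, Real.sqrt_nonneg _, fun x y j hj => ?_⟩
  rw [norm_smul, mul_pow, Real.norm_eq_abs, sq_abs, Real.sq_sqrt (by linarith)]
  have hDy : 0 ≤ D * ‖y‖ ^ 2 := by positivity
  rcases eq_or_ne x 0 with rfl | hx
  · have : j = 0 := by
      have := hj.2
      rw [norm_zero] at this
      exact norm_eq_zero.1 this.symm
    simp only [this, zero_add, norm_zero, zero_apply]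
    nlinarith [sq_nonneg ‖y‖]
  · have hxn : 0 < ‖x‖ := norm_pos_iff.2 hx
    have h1 : ‖‖x‖⁻¹ • x‖ = 1 := by
      rw [norm_smul, norm_inv, norm_norm, inv_mul_cancel₀ hxn.ne']
    have h2 := norm_add_sq_le_of_norm_eq_one hc h h1 (‖x‖⁻¹ • y)
      (normalizedDuality_smul hj (inv_nonneg.2 hxn.le))
    rw [← smul_add, norm_smul, norm_smul, norm_inv, norm_norm, ← hD] at h2
    simp only [smul_apply, map_smul, smul_eq_mul] at h2
    have h3 := mul_le_mul_of_nonneg_left h2 (sq_nonneg ‖x‖)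
    have e1 : ‖x‖ ^ 2 * (‖x‖⁻¹ * ‖x + y‖) ^ 2 = ‖x + y‖ ^ 2 := by field_simp
    have e2 : ‖x‖ ^ 2 * (1 + 2 * (‖x‖⁻¹ * (‖x‖⁻¹ * j y)) + D * (‖x‖⁻¹ * ‖y‖) ^ 2)
        = ‖x‖ ^ 2 + 2 * j y + D * ‖y‖ ^ 2 := by field_simp
    rw [e1, e2] at h3
    linarith

theorem bestSmoothConst_spec (hE : IsQUniformlySmooth E 2) (x y : E) {j : E →L[ℝ] ℝ}
    (hj : j ∈ normalizedDuality x) :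
    ‖x + y‖ ^ 2 ≤ ‖x‖ ^ 2 + 2 * j y + 2 * bestSmoothConst E ^ 2 * ‖y‖ ^ 2 := by
  have hcl : IsClosed {K : ℝ | 0 ≤ K ∧ ∀ x y : E, ∀ j ∈ normalizedDuality x,
      ‖x + y‖ ^ 2 ≤ ‖x‖ ^ 2 + 2 * j y + 2 * ‖K • y‖ ^ 2} := by
    simp only [Set.ofPred_and, Set.ofPred_forall]
    refine (isClosed_le continuous_const continuous_id).inter ?_
    refine isClosed_iInter fun x => isClosed_iInter fun y => isClosed_iInter fun j =>
      isClosed_iInter fun _ => isClosed_le continuous_const ?_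
    fun_prop
  have hmem := hcl.csInf_mem (exists_smoothConst hE) ⟨0, fun K hK => hK.1⟩
  have := hmem.2 x y j hj
  change _ ≤ _ + 2 * ‖bestSmoothConst E • y‖ ^ 2 at this
  rw [norm_smul, mul_pow, Real.norm_eq_abs, sq_abs] at this
  linarith

theorem bestSmoothConst_sq_pos [Nontrivial E] (hE : IsQUniformlySmooth E 2) :
    0 < bestSmoothConst E ^ 2 := by
  obtain ⟨y, hy⟩ := exists_ne (0 : E)
  have h := bestSmoothConst_spec hE (0 : E) y (j := 0) ⟨by simp, by simp⟩
  simp only [zero_add, norm_zero, zero_apply] at h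
  have hy' : 0 < ‖y‖ ^ 2 := by positivity
  by_contra hK
  have : bestSmoothConst E ^ 2 * ‖y‖ ^ 2 ≤ 0 :=
    mul_nonpos_of_nonpos_of_nonneg (not_lt.1 hK) hy'.le
  linarith

/-- In a space satisfying the smoothness inequality, the duality mapping is Lipschitz. -/
theorem normalizedDuality_lipschitz {k : ℝ} (hk0 : 0 ≤ k)
    (hk : ∀ x y : E, ∀ j ∈ normalizedDuality x,
      ‖x + y‖ ^ 2 ≤ ‖x‖ ^ 2 + 2 * j y + 2 * k * ‖y‖ ^ 2)
    {x y : E} {i j : E →L[ℝ] ℝ} (hi : i ∈ normalizedDuality x) (hj : j ∈ normalizedDuality y) :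
    ‖j - i‖ ≤ 4 * k * ‖y - x‖ := by
  -- Smoothness at x bounds ‖x + h‖² above, and the subgradient inequality at y bounds it below; the
  -- subgradient inequality at x removes ‖x‖² - ‖y‖².
  have key : ∀ h : E, (j - i) h ≤ k * ‖h‖ ^ 2 + ‖j - i‖ * ‖y - x‖ := by
    intro h
    have h1 := hk x h i hi
    have h2 := normalizedDuality_subgradient hj (x + h)
    have h3 := normalizedDuality_subgradient hi y
    have h4 : (j - i) (y - x) ≤ ‖j - i‖ * ‖y - x‖ :=
      (le_abs_self _).trans ((j - i).le_opNorm _)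
    simp only [map_sub, map_add, sub_apply] at *
    linarith
  have key2 : ∀ r : ℝ, 0 < r → ‖j - i‖ * r ≤ k * r ^ 2 + ‖j - i‖ * ‖y - x‖ := by
    intro r hr
    rw [← le_div_iff₀ hr]
    refine ContinuousLinearMap.opNorm_le_of_unit_norm (by positivity) fun v hv => ?_
    rw [le_div_iff₀ hr]
    have h1 := key (r • v)
    have h2 := key (-(r • v))
    rw [map_neg, norm_neg] at h2
    rw [norm_smul, hv, mul_one, Real.norm_eq_abs, sq_abs, map_smul, smul_eq_mul] at h1 h2
    rcases abs_cases ((j - i) v) with h | h <;> rw [Real.norm_eq_abs, h.1] <;> linarith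
  -- The radius 2‖y - x‖ gives the constant 4k. When x = y, a radius proportional to ‖j - i‖ gives
  -- ‖j - i‖ ≤ ‖j - i‖ / 2, so J is single-valued.
  rcases (norm_nonneg (y - x)).eq_or_lt with hd | hd
  · rw [← hd, mul_zero]
    by_contra! hpos
    have h1 := key2 (‖j - i‖ / (2 * (|k| + 1))) (by positivity)
    rw [← hd, mul_zero, add_zero, sq, ← mul_assoc] at h1
    have h2 := le_of_mul_le_mul_right h1 (by positivity)
    have h3 : k * (‖j - i‖ / (2 * (|k| + 1))) ≤ ‖j - i‖ / 2 := by
      rw [mul_div_assoc', div_le_div_iff₀ (by positivity) (by positivity)]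
      nlinarith [le_abs_self k]
    linarith
  · have h1 := key2 (2 * ‖y - x‖) (by positivity)
    have h2 : ‖j - i‖ * ‖y - x‖ ≤ (4 * k * ‖y - x‖) * ‖y - x‖ := by linarith
    exact le_of_mul_le_mul_right h2 hd

end Duality

/-! ### Reflexivity and minimization of convex functions -/

section Reflexivity

variable {E : Type*} [NormedAddCommGroup E] [NormedSpace ℝ E]

theorem exists_norm_le_one_lt_apply {F : Type*} [NormedAddCommGroup F] [NormedSpace ℝ F]
    (f : F →L[ℝ] ℝ) {r : ℝ} (hr : r < ‖f‖) : ∃ x, ‖x‖ ≤ 1 ∧ r < f x := by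
  obtain ⟨x, hx, hrx⟩ := f.exists_lt_apply_of_lt_opNorm hr
  rcases le_total 0 (f x) with h | h
  · exact ⟨x, hx.le, by rwa [Real.norm_of_nonneg h] at hrx⟩
  · refine ⟨-x, by rw [norm_neg]; exact hx.le, ?_⟩
    rwa [Real.norm_of_nonpos h, ← map_neg] at hrx

theorem apply_le_of_norm_le_one {F : Type*} [NormedAddCommGroup F] [NormedSpace ℝ F]
    {f : F →L[ℝ] ℝ} {v : F} (hf : ‖f‖ ≤ 1) : f v ≤ ‖v‖ :=
  (le_abs_self _).trans ((f.le_opNorm v).trans (mul_le_of_le_one_left (norm_nonneg _) hf))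

theorem norm_add_add_norm_sub_le {k : ℝ} (hk0 : 0 ≤ k)
    (hk : ∀ x y : E, ∀ j ∈ normalizedDuality x,
      ‖x + y‖ ^ 2 ≤ ‖x‖ ^ 2 + 2 * j y + 2 * k * ‖y‖ ^ 2)
    {x y : E} {h : ℝ} (hx : ‖x‖ ≤ 1) (hy : ‖y‖ ≤ 1) :
    ‖x + h • y‖ + ‖x - h • y‖ ≤ 2 + 2 * k * h ^ 2 := by
  obtain ⟨j, hj⟩ := normalizedDuality_nonempty x
  have h1 := hk x (h • y) j hj
  have h2 := hk x (-(h • y)) j hj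
  rw [← sub_eq_add_neg, map_neg, norm_neg] at h2
  rw [norm_smul, mul_pow, Real.norm_eq_abs, sq_abs] at h1 h2
  have h3 : ‖x‖ ^ 2 ≤ 1 := pow_le_one₀ (norm_nonneg _) hx
  have h4 : ‖y‖ ^ 2 ≤ 1 := pow_le_one₀ (norm_nonneg _) hy
  have h5 : k * h ^ 2 * ‖y‖ ^ 2 ≤ k * h ^ 2 := mul_le_of_le_one_right (by positivity) h4
  have h6 : 0 ≤ k * h ^ 2 := by positivity
  refine abs_le_of_sq_le_sq' ?_ (by positivity) |>.2
  nlinarith [sq_nonneg (‖x + h • y‖ - ‖x - h • y‖), sq_nonneg (k * h ^ 2)]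

/-- Lindenstrauss duality: (i + j)x + h(i - j)y = i(x + hy) + j(x - hy), so smoothness of E becomes
uniform convexity of the dual. -/
theorem dual_norm_add_add_norm_sub_le {k : ℝ} (hk0 : 0 ≤ k)
    (hk : ∀ x y : E, ∀ j ∈ normalizedDuality x,
      ‖x + y‖ ^ 2 ≤ ‖x‖ ^ 2 + 2 * j y + 2 * k * ‖y‖ ^ 2)
    {i j : E →L[ℝ] ℝ} {h : ℝ} (hi : ‖i‖ ≤ 1) (hj : ‖j‖ ≤ 1) (hh : 0 ≤ h) :
    ‖i + j‖ + h * ‖i - j‖ ≤ 2 + 2 * k * h ^ 2 := by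
  refine le_of_forall_pos_le_add fun ε hε => ?_
  have hδ : 0 < ε / (1 + h) := by positivity
  obtain ⟨x, hx, hx'⟩ := exists_norm_le_one_lt_apply (i + j) (sub_lt_self _ hδ)
  obtain ⟨y, hy, hy'⟩ := exists_norm_le_one_lt_apply (i - j) (sub_lt_self _ hδ)
  have h1 := norm_add_add_norm_sub_le hk0 hk (h := h) hx hy
  have h2 : i (x + h • y) ≤ _ := apply_le_of_norm_le_one hi
  have h3 : j (x - h • y) ≤ _ := apply_le_of_norm_le_one hj
  have h4 := mul_le_mul_of_nonneg_left hy'.le hh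
  have h5 : (1 + h) * (ε / (1 + h)) = ε := by field_simp
  simp only [map_add, map_sub, map_smul, smul_eq_mul, add_apply, sub_apply] at *
  linarith

/-- The same exchange once more, with ξ(i + j) + h(i - j)x: smoothness passes to the bidual in
directions from E. -/
theorem bidual_norm_add_add_norm_sub_le {k : ℝ} (hk0 : 0 ≤ k)
    (hk : ∀ x y : E, ∀ j ∈ normalizedDuality x,
      ‖x + y‖ ^ 2 ≤ ‖x‖ ^ 2 + 2 * j y + 2 * k * ‖y‖ ^ 2)
    {ξ : StrongDual ℝ (StrongDual ℝ E)} {x : E} {h : ℝ} (hξ : ‖ξ‖ ≤ 1) (hx : ‖x‖ ≤ 1)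
    (hh : 0 ≤ h) :
    ‖ξ + h • NormedSpace.inclusionInDoubleDual ℝ E x‖
      + ‖ξ - h • NormedSpace.inclusionInDoubleDual ℝ E x‖ ≤ 2 + 2 * k * h ^ 2 := by
  refine le_of_forall_pos_le_add fun ε hε => ?_
  obtain ⟨i, hi, hi'⟩ := exists_norm_le_one_lt_apply
    (ξ + h • NormedSpace.inclusionInDoubleDual ℝ E x) (sub_lt_self _ (half_pos hε))
  obtain ⟨j, hj, hj'⟩ := exists_norm_le_one_lt_apply
    (ξ - h • NormedSpace.inclusionInDoubleDual ℝ E x) (sub_lt_self _ (half_pos hε))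
  have h1 := dual_norm_add_add_norm_sub_le hk0 hk hi hj hh
  have h2 : ξ (i + j) ≤ _ := apply_le_of_norm_le_one hξ
  have h3 : (i - j) x ≤ ‖i - j‖ :=
    (le_abs_self _).trans (((i - j).le_opNorm x).trans
      (mul_le_of_le_one_right (norm_nonneg _) hx))
  have h4 := mul_le_mul_of_nonneg_left h3 hh
  simp only [map_add, smul_apply, smul_eq_mul, add_apply, sub_apply,
    NormedSpace.dual_def] at *
  linarith

/-- Riesz's lemma for the range of a non-surjective isometry. -/
theorem LinearIsometry.exists_norm_eq_one_le_norm_sub [CompleteSpace E] {F : Type*}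
    [NormedAddCommGroup F] [NormedSpace ℝ F] (f : E →ₗᵢ[ℝ] F) (hf : ¬ Function.Surjective f)
    {r : ℝ} (hr : r < 1) : ∃ y : F, ‖y‖ = 1 ∧ ∀ x, r ≤ ‖y - f x‖ := by
  obtain ⟨y', hy'⟩ := not_forall.1 hf
  have hcl : IsClosed (LinearMap.range f.toLinearMap : Set F) :=
    f.isometry.isClosedEmbedding.isClosed_range
  obtain ⟨y, hy, hd⟩ := riesz_lemma hcl ⟨y', fun ⟨v, hv⟩ => hy' ⟨v, hv⟩⟩ hr
  have hn : 0 < ‖y‖ := norm_pos_iff.2 fun h0 => hy (h0 ▸ Submodule.zero_mem _)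
  refine ⟨‖y‖⁻¹ • y, by rw [norm_smul, norm_inv, norm_norm, inv_mul_cancel₀ hn.ne'],
    fun x => ?_⟩
  have h1 := hd (‖y‖ • f x) ⟨‖y‖ • x, by simp⟩
  have e : y - ‖y‖ • f x = ‖y‖ • (‖y‖⁻¹ • y - f x) := by
    rw [smul_sub, smul_inv_smul₀ hn.ne']
  rw [e, norm_smul, norm_norm, mul_comm] at h1
  exact le_of_mul_le_mul_left h1 hn

theorem exists_norm_eq_one_le_norm_sub_of_dual [CompleteSpace E] {G : Type*}
    [NormedAddCommGroup G] [NormedSpace ℝ G] (f : E →L[ℝ] StrongDual ℝ G)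
    (hf : ∀ x, ‖f x‖ = ‖x‖) (hs : ¬ Function.Surjective f) {r : ℝ} (hr : r < 1) :
    ∃ ξ : StrongDual ℝ G, ‖ξ‖ = 1 ∧ ∀ x, r ≤ ‖ξ - f x‖ := by
  let ι : E →ₗᵢ[ℝ] StrongDual ℝ G := ⟨f.toLinearMap, hf⟩
  exact ι.exists_norm_eq_one_le_norm_sub hs hr

/-- A Banach space satisfying the smoothness inequality is reflexive. -/
theorem inclusionInDoubleDual_surjective [CompleteSpace E] {k : ℝ} (hk0 : 0 ≤ k)
    (hk : ∀ x y : E, ∀ j ∈ normalizedDuality x,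
      ‖x + y‖ ^ 2 ≤ ‖x‖ ^ 2 + 2 * j y + 2 * k * ‖y‖ ^ 2) :
    Function.Surjective (NormedSpace.inclusionInDoubleDual ℝ E) := by
  by_contra hs
  -- If E were not reflexive, a unit ξ nearly at distance 1 from E and an x nearly aligned with it
  -- would give ‖ξ + hx‖ + ‖ξ - hx‖ > r(1 + h) + r = 2 + 3h/4, while smoothness allows at most 2 +
  -- h/2.
  obtain ⟨h, hpos, hkh⟩ : ∃ h : ℝ, 0 < h ∧ 2 * k * h ^ 2 ≤ h / 2 := by
    refine ⟨1 / (4 * (k + 1)), by positivity, ?_⟩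
    field_simp; linarith
  obtain ⟨r, hr1, hr⟩ : ∃ r : ℝ, r < 1 ∧ r * (2 + h) = 2 + 3 / 4 * h :=
    ⟨(2 + 3 / 4 * h) / (2 + h), by rw [div_lt_one (by positivity)]; linarith, by field_simp⟩
  obtain ⟨ξ, hξ, hd⟩ := exists_norm_eq_one_le_norm_sub_of_dual
    (NormedSpace.inclusionInDoubleDual ℝ E)
    (NormedSpace.inclusionInDoubleDualLi (E := E) ℝ).norm_map hs hr1
  obtain ⟨j, hj, hrj⟩ := exists_norm_le_one_lt_apply ξ (hξ.symm ▸ hr1)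
  have hj' : r < ‖j‖ := hrj.trans_le (apply_le_of_norm_le_one hξ.le)
  obtain ⟨x, hx, hrx⟩ := exists_norm_le_one_lt_apply j hj'
  have h1 := bidual_norm_add_add_norm_sub_le hk0 hk hξ.le hx hpos.le
  have h2 : ξ j + h * j x ≤ ‖ξ + h • NormedSpace.inclusionInDoubleDual ℝ E x‖ := by
    refine le_trans ?_ ((ContinuousLinearMap.le_opNorm _ j).trans
      (mul_le_of_le_one_right (norm_nonneg _) hj))
    rw [add_apply, smul_apply, NormedSpace.dual_def, smul_eq_mul]
    exact le_abs_self _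
  have h3 : r ≤ ‖ξ - h • NormedSpace.inclusionInDoubleDual ℝ E x‖ := by
    rw [← map_smul]
    exact hd (h • x)
  have h5 := mul_le_mul_of_nonneg_left hrx.le hpos.le
  linarith

theorem exists_tendsto_hyperfilter {a : ℕ → ℝ} {B : ℝ} (h : ∀ n, |a n| ≤ B) :
    ∃ l, Tendsto a (hyperfilter ℕ) (𝓝 l) := by
  obtain ⟨l, -, hl⟩ := (isCompact_Icc (a := -B) (b := B)).ultrafilter_le_nhds'
    ((hyperfilter ℕ).map a) (Ultrafilter.mem_map.2 (univ_mem' fun n => abs_le.1 (h n)))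
  exact ⟨l, hl⟩

theorem hyperfilter_nat_le_atTop : (hyperfilter ℕ : Filter ℕ) ≤ atTop :=
  Nat.cofinite_eq_atTop ▸ hyperfilter_le_cofinite

/-- A bounded sequence in a reflexive space has a point that lies in every closed convex set
containing almost all of its terms. -/
theorem exists_mem_of_eventually_mem
    (hrefl : Function.Surjective (NormedSpace.inclusionInDoubleDual ℝ E))
    {x : ℕ → E} {B : ℝ} (hB : ∀ n, ‖x n‖ ≤ B) :
    ∃ y, ∀ D : Set E, IsClosed D → Convex ℝ D → (∀ᶠ n in atTop, x n ∈ D) → y ∈ D := by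
  have hb : ∀ (j : StrongDual ℝ E) n, |j (x n)| ≤ B * ‖j‖ := fun j n =>
    (j.le_opNorm (x n)).trans (by
      rw [mul_comm]; exact mul_le_mul_of_nonneg_right (hB n) (norm_nonneg _))
  -- Limits along one ultrafilter are linear in j, so they define a bidual element, which
  -- reflexivity represents by a point.
  choose L hL using fun j => exists_tendsto_hyperfilter (hb j)
  let L' : StrongDual ℝ E →ₗ[ℝ] ℝ :=
    { toFun := L
      map_add' := fun i j => tendsto_nhds_unique (hL (i + j)) ((hL i).add (hL j))
      map_smul' := fun c j => tendsto_nhds_unique (hL (c • j)) ((hL j).const_mul c) }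
  obtain ⟨y, hy⟩ := hrefl (L'.mkContinuous B fun j =>
    le_of_tendsto (hL j).abs (Eventually.of_forall (hb j)))
  have hy' : ∀ j : StrongDual ℝ E, j y = L j := fun j => by
    rw [← NormedSpace.dual_def ℝ E y j, hy]; rfl
  refine ⟨y, fun D hD hDc hx => ?_⟩
  by_contra hyD
  obtain ⟨j, a, hja, haj⟩ := geometric_hahn_banach_point_closed hDc hD hyD
  have : a ≤ L j := ge_of_tendsto (hL j)
    ((hx.filter_mono hyperfilter_nat_le_atTop).mono fun n hn => (haj _ hn).le)
  linarith [hy' j]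

/-- A coercive continuous convex function on a closed convex subset of a reflexive space attains
its minimum. -/
theorem exists_isMinOn_of_convexOn
    (hrefl : Function.Surjective (NormedSpace.inclusionInDoubleDual ℝ E))
    {C : Set E} (hC : IsClosed C) (hne : C.Nonempty) {f : E → ℝ}
    (hf : ConvexOn ℝ C f) (hfc : Continuous f) {R : ℝ} (hf0 : ∀ x, 0 ≤ f x)
    (hR : ∀ x, ‖x‖ ≤ f x + R) : ∃ x ∈ C, ∀ y ∈ C, f x ≤ f y := by
  set m := sInf (f '' C) with hm
  have hbdd : BddBelow (f '' C) := ⟨0, by rintro _ ⟨x, -, rfl⟩; exact hf0 x⟩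
  have hex : ∀ n : ℕ, ∃ x ∈ C, f x < m + 1 / ((n : ℝ) + 1) := fun n => by
    obtain ⟨_, ⟨x, hx, rfl⟩, hlt⟩ := exists_lt_of_csInf_lt (hne.image f)
      (lt_add_of_pos_right m (Nat.one_div_pos_of_nat (α := ℝ) (n := n)))
    exact ⟨x, hx, hlt⟩
  choose x hxC hx using hex
  have hle : ∀ n : ℕ, 1 / ((n : ℝ) + 1) ≤ 1 := fun n => by
    rw [div_le_one (by positivity)]; linarith [n.cast_nonneg (α := ℝ)]
  obtain ⟨y, hy⟩ := exists_mem_of_eventually_mem hrefl (x := x) (B := m + 1 + R) fun n => by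
    linarith [hR (x n), hx n, hle n]
  have hyC : y ∈ C := hy C hC hf.1 (Eventually.of_forall hxC)
  refine ⟨y, hyC, fun z hz => ?_⟩
  have hfy : f y ≤ m := by
    refine le_of_forall_pos_le_add fun ε hε => ?_
    have := hy {z ∈ C | f z ≤ m + ε} (hC.inter (isClosed_le hfc continuous_const))
      (hf.convex_le _) ?_
    · exact this.2
    · filter_upwards [(tendsto_one_div_add_atTop_nhds_zero_nat (𝕜 := ℝ)).eventually_lt_const hε]
        with n hn
      exact ⟨hxC n, by linarith [hx n]⟩
  exact hfy.trans (csInf_le hbdd ⟨z, hz, rfl⟩)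

end Reflexivity

/-! ### Cocoercivity of I - T, relaxed maps and resolvents -/

section Cocoercive

variable {E : Type*} [NormedAddCommGroup E] [NormedSpace ℝ E]

/-- Since J is single-valued, the functional provided by the definition is the given one. -/
theorem IsStrictPseudocontractionOn.cocoercive {k : ℝ} (hk0 : 0 ≤ k)
    (hk : ∀ x y : E, ∀ j ∈ normalizedDuality x,
      ‖x + y‖ ^ 2 ≤ ‖x‖ ^ 2 + 2 * j y + 2 * k * ‖y‖ ^ 2)
    {lam : ℝ} {T : E → E} {C : Set E} (hT : IsStrictPseudocontractionOn lam T C)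
    {x y : E} (hx : x ∈ C) (hy : y ∈ C) {j : E →L[ℝ] ℝ} (hj : j ∈ normalizedDuality (x - y)) :
    lam * ‖x - T x - (y - T y)‖ ^ 2 ≤ j (x - T x - (y - T y)) := by
  obtain ⟨i, hi, hiT⟩ := hT x hx y hy
  have hij : j = i := by
    have := normalizedDuality_lipschitz hk0 hk hi hj
    rw [sub_self, norm_zero, mul_zero] at this
    exact sub_eq_zero.1 (norm_le_zero_iff.1 this)
  have e : x - T x - (y - T y) = x - y - (T x - T y) := by abel
  rw [e, hij, map_sub i (x - y), normalizedDuality_apply_self hi]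
  linarith

theorem norm_relaxed_sub_sq_le {k : ℝ} (hk0 : 0 ≤ k)
    (hk : ∀ x y : E, ∀ j ∈ normalizedDuality x,
      ‖x + y‖ ^ 2 ≤ ‖x‖ ^ 2 + 2 * j y + 2 * k * ‖y‖ ^ 2)
    {lam : ℝ} {T : E → E} {C : Set E} (hT : IsStrictPseudocontractionOn lam T C)
    {x y : E} (hx : x ∈ C) (hy : y ∈ C) {a : ℝ} (ha : 0 ≤ a) :
    ‖x - a • (x - T x) - (y - a • (y - T y))‖ ^ 2
      ≤ ‖x - y‖ ^ 2 - 2 * (a * (lam - k * a)) * ‖x - T x - (y - T y)‖ ^ 2 := by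
  obtain ⟨j, hj⟩ := normalizedDuality_nonempty (x - y)
  have h1 := hT.cocoercive hk0 hk hx hy hj
  have h2 := hk (x - y) (-(a • (x - T x - (y - T y)))) j hj
  have e : x - y + -(a • (x - T x - (y - T y)))
      = x - a • (x - T x) - (y - a • (y - T y)) := by
    rw [smul_sub a (x - T x)]; abel
  rw [e, map_neg, norm_neg, norm_smul, mul_pow, Real.norm_eq_abs, sq_abs, map_smul,
    smul_eq_mul] at h2
  have h3 := mul_le_mul_of_nonneg_left h1 ha
  linarith

theorem relaxed_mem {T : E → E} {C : Set E} (hC : Convex ℝ C) (hTC : Set.MapsTo T C C)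
    {x : E} (hx : x ∈ C) {a : ℝ} (ha : a ∈ Set.Icc (0 : ℝ) 1) : x - a • (x - T x) ∈ C := by
  have := hC hx (hTC hx) (sub_nonneg.2 ha.2) ha.1 (by ring)
  convert this using 1
  rw [smul_sub, sub_smul, one_smul]; abel

theorem norm_relaxed_sub_le {k : ℝ} (hk0 : 0 ≤ k)
    (hk : ∀ x y : E, ∀ j ∈ normalizedDuality x,
      ‖x + y‖ ^ 2 ≤ ‖x‖ ^ 2 + 2 * j y + 2 * k * ‖y‖ ^ 2)
    {lam : ℝ} {T : E → E} {C : Set E} (hT : IsStrictPseudocontractionOn lam T C)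
    {x y : E} (hx : x ∈ C) (hy : y ∈ C) {a : ℝ} (ha : 0 ≤ a) (hka : k * a ≤ lam) :
    ‖x - a • (x - T x) - (y - a • (y - T y))‖ ≤ ‖x - y‖ := by
  have h1 := norm_relaxed_sub_sq_le hk0 hk hT hx hy ha
  have h2 : 0 ≤ 2 * (a * (lam - k * a)) * ‖x - T x - (y - T y)‖ ^ 2 :=
    mul_nonneg (mul_nonneg zero_le_two (mul_nonneg ha (sub_nonneg.2 hka))) (sq_nonneg _)
  exact (sq_le_sq₀ (norm_nonneg _) (norm_nonneg _)).1 (by linarith)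

/-- Solvability of the resolvent equation with anchor `u` for the operator `I - T`. -/
theorem exists_resolvent [CompleteSpace E] {k : ℝ} (hk0 : 0 ≤ k)
    (hk : ∀ x y : E, ∀ j ∈ normalizedDuality x,
      ‖x + y‖ ^ 2 ≤ ‖x‖ ^ 2 + 2 * j y + 2 * k * ‖y‖ ^ 2)
    {lam : ℝ} {T : E → E} {C : Set E} (hT : IsStrictPseudocontractionOn lam T C)
    (hC : IsClosed C) (hCc : Convex ℝ C) (hTC : Set.MapsTo T C C)
    {a : ℝ} (ha : 0 < a) (ha1 : a ≤ 1) (hka : k * a ≤ lam)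
    {u : E} (hu : u ∈ C) {τ : ℝ} (hτ : 0 < τ) :
    ∃ z ∈ C, z - T z = τ • (u - z) := by
  have hs : 0 < 1 + τ * a := by positivity
  -- With this s one has 1 - s = saτ, so fixed points of the contraction `G` are exactly the
  -- solutions.
  set s : ℝ := (1 + τ * a)⁻¹ with hsdef
  have hs0 : 0 < s := inv_pos.2 hs
  have hs1 : s < 1 := inv_lt_one_of_one_lt₀ (by linarith [mul_pos hτ ha])
  let G : E → E := fun z => (1 - s) • u + s • (z - a • (z - T z))
  have hG : Set.MapsTo G C C := fun z hz =>
    hCc hu (relaxed_mem hCc hTC hz ⟨ha.le, ha1⟩) (by linarith) hs0.le (by ring)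
  have hcontr : ContractingWith ⟨s, hs0.le⟩ (hG.restrict G C C) := by
    refine ⟨by exact_mod_cast hs1, LipschitzWith.of_dist_le_mul fun x y => ?_⟩
    have h1 := norm_relaxed_sub_le hk0 hk hT x.2 y.2 ha.le hka
    rw [Subtype.dist_eq, Subtype.dist_eq, dist_eq_norm, dist_eq_norm]
    change ‖(1 - s) • u + s • ((x : E) - a • (x - T x))
      - ((1 - s) • u + s • ((y : E) - a • (y - T y)))‖ ≤ s * ‖(x : E) - y‖
    rw [add_sub_add_left_eq_sub, ← smul_sub, norm_smul, Real.norm_of_nonneg hs0.le]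
    gcongr
  obtain ⟨z, hz, hfix, -⟩ := hcontr.exists_fixedPoint' hC.isComplete hG hu (edist_ne_top _ _)
  refine ⟨z, hz, ?_⟩
  have h1 : (1 - s) • u + s • (z - a • (z - T z)) = z := hfix
  have h2 : s • a • (z - T z) = (1 - s) • (u - z) := by
    have : s • a • (z - T z) = (1 - s) • u + s • z - z := by
      have h' : s • z - s • a • (z - T z) = z - (1 - s) • u := by
        rw [← smul_sub]; exact eq_sub_of_add_eq' h1
      rw [add_sub_assoc, ← sub_sub_self (s • z) (s • a • (z - T z)), h']; abel
    rw [this, smul_sub, sub_smul 1 s z, one_smul]; abel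
  have h3 : 1 - s = s * a * τ := by
    rw [hsdef]; field_simp; ring
  rw [h3, smul_smul, mul_smul (s * a)] at h2
  exact smul_right_injective E (mul_pos hs0 ha).ne' h2

end Cocoercive

/-! ### Asymptotic radius and the limiting fixed point -/

section Asymptotic

variable {E : Type*} [NormedAddCommGroup E] [NormedSpace ℝ E]

/-- The asymptotic radius function of a bounded sequence along an ultrafilter. -/
theorem exists_asymptoticRadius {z : ℕ → E} {R : ℝ} (hR : ∀ n, ‖z n‖ ≤ R) :
    ∃ f : E → ℝ, (∀ x, Tendsto (fun n => ‖z n - x‖) (hyperfilter ℕ) (𝓝 (f x))) ∧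
      ConvexOn ℝ Set.univ f ∧ Continuous f ∧ (∀ x, 0 ≤ f x) ∧ ∀ x, ‖x‖ ≤ f x + R := by
  have hb : ∀ x n, |‖z n - x‖| ≤ R + ‖x‖ := fun x n => by
    rw [abs_norm]; exact (norm_sub_le _ _).trans (by linarith [hR n])
  choose f hf using fun x => exists_tendsto_hyperfilter (hb x)
  refine ⟨f, hf, ⟨convex_univ, ?_⟩, ?_, ?_, ?_⟩
  · intro x _ y _ a b ha hb' hab
    refine le_of_tendsto_of_tendsto' (hf _) (((hf x).const_mul a).add ((hf y).const_mul b))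
      fun n => ?_
    have e : z n - (a • x + b • y) = a • (z n - x) + b • (z n - y) := by
      rw [smul_sub, smul_sub, sub_add_sub_comm, ← add_smul, hab, one_smul]
    rw [e]
    refine (norm_add_le _ _).trans ?_
    rw [norm_smul, norm_smul, Real.norm_of_nonneg ha, Real.norm_of_nonneg hb']
  · refine (LipschitzWith.of_le_add fun x y => ?_ : LipschitzWith 1 f).continuous
    refine le_of_tendsto_of_tendsto' (hf x) ((hf y).add_const _) fun n => ?_
    have := norm_sub_le_norm_sub_add_norm_sub (z n) y x
    rwa [dist_comm, dist_eq_norm]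
  · exact fun x => ge_of_tendsto' (hf x) fun n => norm_nonneg _
  · intro x
    refine ge_of_tendsto' ((hf x).add_const R) fun n => ?_
    have := norm_sub_norm_le x (z n)
    rw [norm_sub_rev] at this
    linarith [hR n]

/-- Cocoercivity against a fixed point gives j(u - z) ≥ 0, and ‖z - p‖² = j(u - p) - j(u - z). -/
theorem norm_resolvent_sub_sq_le {k : ℝ} (hk0 : 0 ≤ k)
    (hk : ∀ x y : E, ∀ j ∈ normalizedDuality x,
      ‖x + y‖ ^ 2 ≤ ‖x‖ ^ 2 + 2 * j y + 2 * k * ‖y‖ ^ 2)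
    {lam : ℝ} (hlam : 0 ≤ lam) {T : E → E} {C : Set E}
    (hT : IsStrictPseudocontractionOn lam T C)
    {p z u : E} (hp : p ∈ C) (hTp : T p = p) (hz : z ∈ C) {τ : ℝ} (hτ : 0 < τ)
    (hzτ : z - T z = τ • (u - z)) {j : E →L[ℝ] ℝ} (hj : j ∈ normalizedDuality (z - p)) :
    ‖z - p‖ ^ 2 ≤ j (u - p) := by
  have h1 := hT.cocoercive hk0 hk hz hp hj
  rw [hTp, sub_self, sub_zero, hzτ, map_smul, smul_eq_mul] at h1
  have h2 : 0 ≤ τ * j (u - z) := le_trans (by positivity) h1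
  have h3 : 0 ≤ j (u - z) := nonneg_of_mul_nonneg_right h2 hτ
  have h4 := normalizedDuality_apply_self hj
  rw [map_sub] at *
  linarith

/-- Some fixed point of `T` is a limit of solutions of the resolvent equation with anchor `u`. -/
theorem exists_fixedPoint_near_resolvents [CompleteSpace E] {k : ℝ} (hk0 : 0 < k)
    (hk : ∀ x y : E, ∀ j ∈ normalizedDuality x,
      ‖x + y‖ ^ 2 ≤ ‖x‖ ^ 2 + 2 * j y + 2 * k * ‖y‖ ^ 2)
    {lam : ℝ} (hlam : 0 < lam) {T : E → E} {C : Set E}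
    (hT : IsStrictPseudocontractionOn lam T C)
    (hC : IsClosed C) (hCc : Convex ℝ C) (hTC : Set.MapsTo T C C)
    {p u : E} (hp : p ∈ C) (hTp : T p = p) (hu : u ∈ C) :
    ∃ q ∈ C, T q = q ∧ ∀ ε > (0 : ℝ), ∃ τ > (0 : ℝ), ∃ z ∈ C, z - T z = τ • (u - z) ∧ ‖z - q‖ < ε := by
  have hrefl := inclusionInDoubleDual_surjective hk0.le hk
  obtain ⟨a, ha, ha1, hka⟩ : ∃ a : ℝ, 0 < a ∧ a ≤ 1 ∧ k * a < lam := by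
    refine ⟨min 1 (lam / (2 * k)), by positivity, min_le_left _ _, ?_⟩
    calc k * min 1 (lam / (2 * k)) ≤ k * (lam / (2 * k)) := by gcongr; exact min_le_right _ _
      _ = lam / 2 := by field_simp
      _ < lam := half_lt_self hlam
  have hτ : ∀ n : ℕ, 0 < 1 / ((n : ℝ) + 1) := fun n => Nat.one_div_pos_of_nat
  choose z hzC hz using fun n => exists_resolvent hk0.le hk hT hC hCc hTC ha ha1 hka.le hu (hτ n)
  have hzp : ∀ n, ‖z n - p‖ ≤ ‖u - p‖ := fun n => by
    obtain ⟨j, hj⟩ := normalizedDuality_nonempty (z n - p)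
    have h1 := norm_resolvent_sub_sq_le hk0.le hk hlam.le hT hp hTp (hzC n) (hτ n) (hz n) hj
    have h2 := normalizedDuality_apply_le hj (u - p)
    by_contra! h
    nlinarith [norm_nonneg (u - p)]
  have hzR : ∀ n, ‖z n‖ ≤ ‖u - p‖ + ‖p‖ := fun n => by
    have := norm_sub_norm_le (z n) p
    linarith [hzp n]
  obtain ⟨f, hf, hfconv, hfcont, hf0, hfR⟩ := exists_asymptoticRadius hzR
  have hAz : Tendsto (fun n => ‖z n - T (z n)‖) atTop (𝓝 0) := by
    have h1 : Tendsto (fun n : ℕ => 1 / ((n : ℝ) + 1) * (2 * ‖u - p‖)) atTop (𝓝 0) := by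
      simpa using (tendsto_one_div_add_atTop_nhds_zero_nat (𝕜 := ℝ)).mul_const (2 * ‖u - p‖)
    refine squeeze_zero (fun n => norm_nonneg _) (fun n => ?_) h1
    rw [hz n, norm_smul, Real.norm_of_nonneg (hτ n).le]
    have h2 := norm_sub_le_norm_sub_add_norm_sub u p (z n)
    rw [norm_sub_rev p] at h2
    have h3 := hzp n
    have h4 := (hτ n).le
    gcongr
    linarith
  obtain ⟨x₀, hx₀C, hx₀⟩ := exists_isMinOn_of_convexOn hrefl hC ⟨u, hu⟩
    (hfconv.subset (Set.subset_univ _) hCc) hfcont hf0 hfR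
  set M : Set E := {x ∈ C | f x ≤ f x₀} with hM
  have hMcl : IsClosed M := hC.inter (isClosed_le hfcont continuous_const)
  have hMc : Convex ℝ M := (hfconv.subset (Set.subset_univ _) hCc).convex_le _
  -- The relaxed map is nonexpansive and almost fixes `z n`, so it does not increase the asymptotic
  -- radius.
  have hMinv : ∀ x ∈ M, x - a • (x - T x) ∈ M := by
    rintro x ⟨hxC, hxf⟩
    refine ⟨relaxed_mem hCc hTC hxC ⟨ha.le, ha1⟩, le_trans ?_ hxf⟩
    have h1 : Tendsto (fun n => ‖z n - x‖ + a * ‖z n - T (z n)‖) (hyperfilter ℕ)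
        (𝓝 (f x + a * 0)) :=
      (hf x).add ((hAz.mono_left hyperfilter_nat_le_atTop).const_mul a)
    rw [mul_zero, add_zero] at h1
    refine le_of_tendsto_of_tendsto' (hf _) h1 fun n => ?_
    have h2 := norm_relaxed_sub_le hk0.le hk hT (hzC n) hxC ha.le hka.le
    have e : z n - (x - a • (x - T x))
        = (z n - a • (z n - T (z n)) - (x - a • (x - T x))) + a • (z n - T (z n)) := by abel
    rw [e]
    refine (norm_add_le _ _).trans ?_
    rw [norm_smul, Real.norm_of_nonneg ha.le]
    gcongr
  have hconvp : ConvexOn ℝ M fun x => ‖x - p‖ := by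
    simpa only [dist_eq_norm] using convexOn_dist p hMc
  obtain ⟨q, hqM, hq⟩ := exists_isMinOn_of_convexOn hrefl hMcl ⟨x₀, hx₀C, le_rfl⟩ hconvp
    (by fun_prop) (R := ‖p‖) (fun x => norm_nonneg _)
    (fun x => by linarith [norm_sub_norm_le x p])
  -- Since ka < λ strictly, the relaxed map would bring q strictly closer to p within `M` unless Tq
  -- = q.
  have hTq : T q = q := by
    have h1 := hq _ (hMinv q hqM)
    have h2 := norm_relaxed_sub_sq_le hk0.le hk hT hqM.1 hp ha.le
    rw [hTp, sub_self, smul_zero, sub_zero, sub_zero] at h2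
    have h3 : ‖q - p‖ ^ 2 ≤ ‖q - a • (q - T q) - p‖ ^ 2 := by gcongr
    have h4 : 0 < 2 * (a * (lam - k * a)) :=
      mul_pos two_pos (mul_pos ha (sub_pos.2 hka))
    have h5 : ‖q - T q‖ ^ 2 ≤ 0 := by
      by_contra! h
      linarith [mul_pos h4 h]
    have h6 : ‖q - T q‖ = 0 := by
      have := sq_nonneg ‖q - T q‖
      exact pow_eq_zero_iff two_ne_zero |>.1 (le_antisymm h5 this)
    exact (sub_eq_zero.1 (norm_eq_zero.1 h6)).symm
  have hmin : ∀ y ∈ C, f q ≤ f y := fun y hy => hqM.2.trans (hx₀ y hy)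
  -- Minimality of q is tested at q + h(u - q). Smoothness and ‖z - q‖² ≤ j(u - q) give f(q)² ≤ (1 -
  -- 2h)f(q)² + 2kh²‖u - q‖², and letting h → 0 will give f(q) = 0.
  have hsmall : ∀ h ∈ Set.Ioc (0 : ℝ) 1, f q ^ 2 ≤ k * ‖u - q‖ ^ 2 * h := by
    intro h hh
    have h1 : f q ≤ f (q + h • (u - q)) := hmin _ (by
      have := hCc hqM.1 hu (sub_nonneg.2 hh.2) hh.1.le (by ring)
      convert this using 1
      rw [smul_sub, sub_smul, one_smul]; abel)
    have h2 : f (q + h • (u - q)) ^ 2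
        ≤ f q ^ 2 * (1 - 2 * h) + 2 * k * (h ^ 2 * ‖u - q‖ ^ 2) := by
      refine le_of_tendsto_of_tendsto' ((hf _).pow 2)
        ((((hf q).pow 2).mul_const _).add_const _) fun n => ?_
      obtain ⟨j, hj⟩ := normalizedDuality_nonempty (z n - q)
      have h3 := hk (z n - q) (-(h • (u - q))) j hj
      have h4 := norm_resolvent_sub_sq_le hk0.le hk hlam.le hT hqM.1 hTq (hzC n) (hτ n) (hz n) hj
      have e : z n - q + -(h • (u - q)) = z n - (q + h • (u - q)) := by abel
      rw [e, map_neg, norm_neg, norm_smul, mul_pow, Real.norm_eq_abs, sq_abs, map_smul,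
        smul_eq_mul] at h3
      have h5 := mul_le_mul_of_nonneg_left h4 hh.1.le
      linarith
    have h3 : f q ^ 2 ≤ f (q + h • (u - q)) ^ 2 := by
      have := hf0 q
      gcongr
    have h4 : h * f q ^ 2 ≤ h * (k * ‖u - q‖ ^ 2 * h) := by linarith
    exact le_of_mul_le_mul_left h4 hh.1
  have hfq : f q = 0 := by
    have h1 : Tendsto (fun n : ℕ => k * ‖u - q‖ ^ 2 * (1 / ((n : ℝ) + 1))) atTop (𝓝 0) := by
      simpa using (tendsto_one_div_add_atTop_nhds_zero_nat (𝕜 := ℝ)).const_mul (k * ‖u - q‖ ^ 2)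
    have h2 : f q ^ 2 ≤ 0 := ge_of_tendsto' h1 fun n => hsmall _ ⟨hτ n, by
      rw [div_le_one (by positivity)]; linarith [n.cast_nonneg (α := ℝ)]⟩
    exact pow_eq_zero_iff two_ne_zero |>.1 (le_antisymm h2 (sq_nonneg _))
  refine ⟨q, hqM.1, hTq, fun ε hε => ?_⟩
  obtain ⟨n, hn⟩ := ((hf q).eventually_lt_const (hfq.symm ▸ hε)).exists
  exact ⟨_, hτ n, z n, hzC n, hz n, hn⟩

end Asymptotic

/-- The excess over ε shrinks by the factor 1 - β ≤ exp(-β), hence decays exponentially in the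
divergent partial sums. -/
theorem eventually_le_two_mul_of_recursion {s β : ℕ → ℝ} {ε : ℝ} (hε : 0 < ε)
    (hβ : ∀ n, β n ∈ Set.Ioo (0 : ℝ) 1)
    (hβsum : Tendsto (fun N => ∑ n ∈ Finset.range N, β n) atTop atTop)
    (h : ∀ᶠ n in atTop, s (n + 1) ≤ (1 - β n) * s n + β n * ε) :
    ∀ᶠ n in atTop, s n ≤ 2 * ε := by
  obtain ⟨N, hN⟩ := eventually_atTop.1 h
  set B : ℕ → ℝ := fun N => ∑ n ∈ Finset.range N, β n with hB
  set D := |s N - ε| with hD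
  have hind : ∀ n ≥ N, s n - ε ≤ D * Real.exp (-(B n - B N)) := by
    intro n hn
    induction n, hn using Nat.le_induction with
    | base => simpa using le_abs_self (s N - ε)
    | succ n hn ih =>
      have h1 := hN n hn
      have h2 : B (n + 1) = B n + β n := Finset.sum_range_succ _ _
      have h3 : 1 - β n ≤ Real.exp (-β n) := Real.one_sub_le_exp_neg _
      have h4 : 0 ≤ 1 - β n := by linarith [(hβ n).2]
      calc s (n + 1) - ε ≤ (1 - β n) * (s n - ε) := by linarith
        _ ≤ (1 - β n) * (D * Real.exp (-(B n - B N))) := by gcongr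
        _ ≤ Real.exp (-β n) * (D * Real.exp (-(B n - B N))) := by gcongr
        _ = D * Real.exp (-(B (n + 1) - B N)) := by
          rw [mul_left_comm, ← Real.exp_add, h2]; ring_nf
  have hlim : Tendsto (fun n => D * Real.exp (-(B n - B N))) atTop (𝓝 0) := by
    have : Tendsto (fun n => Real.exp (-(B n - B N))) atTop (𝓝 0) :=
      Real.tendsto_exp_neg_atTop_nhds_zero.comp (tendsto_atTop_add_const_right _ (-B N) hβsum)
    simpa using this.const_mul D
  filter_upwards [hlim.eventually_lt_const hε, eventually_ge_atTop N] with n h1 h2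
  linarith [hind n h2]

/-! ### Convergence of the Halpern iteration -/

section Halpern

variable {E : Type*} [NormedAddCommGroup E] [NormedSpace ℝ E]

/-- If `q` is close to a solution `z` of the resolvent equation, then `⟨u - q, J(w - q)⟩` is
controlled by the residual `‖x - T x‖` at a point `x` near `w`. -/
theorem normalizedDuality_anchor_le {k : ℝ} (hk0 : 0 ≤ k)
    (hk : ∀ x y : E, ∀ j ∈ normalizedDuality x,
      ‖x + y‖ ^ 2 ≤ ‖x‖ ^ 2 + 2 * j y + 2 * k * ‖y‖ ^ 2)
    {lam : ℝ} (hlam : 0 ≤ lam) {T : E → E} {C : Set E}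
    (hT : IsStrictPseudocontractionOn lam T C)
    {x w z q u : E} (hx : x ∈ C) (hz : z ∈ C) {τ : ℝ} (hτ : 0 < τ)
    (hzτ : z - T z = τ • (u - z)) {j : E →L[ℝ] ℝ} (hj : j ∈ normalizedDuality (w - q)) :
    j (u - q) ≤ ‖x - z‖ * ‖x - T x‖ / τ
      + 4 * k * (‖w - x‖ + ‖z - q‖) * ‖u - z‖ + ‖w - q‖ * ‖z - q‖ := by
  obtain ⟨i, hi⟩ := normalizedDuality_nonempty (x - z)
  -- Cocoercivity between x and z gives τ i(u - z) ≤ i(x - Tx) for i in J(x - z); the Lipschitz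
  -- bound then passes from i to j.
  have h1 := hT.cocoercive hk0 hk hx hz hi
  have h2 : 0 ≤ i (x - T x - (z - T z)) := le_trans (by positivity) h1
  rw [hzτ, map_sub i (x - T x), map_smul, smul_eq_mul] at h2
  have h3 := normalizedDuality_apply_le hi (x - T x)
  have h4 : i (u - z) ≤ ‖x - z‖ * ‖x - T x‖ / τ := by
    rw [le_div_iff₀ hτ]; linarith
  have h5 : (j - i) (u - z) ≤ 4 * k * (‖w - x‖ + ‖z - q‖) * ‖u - z‖ := by
    refine (le_abs_self _).trans (((j - i).le_opNorm _).trans ?_)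
    gcongr
    refine (normalizedDuality_lipschitz hk0 hk hi hj).trans ?_
    gcongr
    rw [show w - q - (x - z) = (w - x) + (z - q) by abel]
    exact norm_add_le _ _
  have h6 := normalizedDuality_apply_le hj (z - q)
  have h7 : j (u - q) = i (u - z) + (j - i) (u - z) + j (z - q) := by
    simp only [sub_apply, map_sub]; ring
  linarith

/-- The residual need not be shown to vanish beforehand: it enters the anchor term with factor β_n,
and the quadratic gain absorbs it at a cost O(β_n²). -/
theorem halpern_tendsto [CompleteSpace E] {k : ℝ} (hk0 : 0 < k)
    (hk : ∀ x y : E, ∀ j ∈ normalizedDuality x,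
      ‖x + y‖ ^ 2 ≤ ‖x‖ ^ 2 + 2 * j y + 2 * k * ‖y‖ ^ 2)
    {lam : ℝ} (hlam : 0 < lam) {T : E → E} {C : Set E}
    (hT : IsStrictPseudocontractionOn lam T C)
    (hC : IsClosed C) (hCc : Convex ℝ C) (hTC : Set.MapsTo T C C)
    {p : E} (hp : p ∈ C) (hTp : T p = p)
    {α β : ℕ → ℝ} (hα : ∀ n, α n ∈ Set.Icc (0 : ℝ) 1) (hkα : ∀ n, k * α n ≤ lam)
    {c : ℝ} (hc : 0 < c) (hαc : ∀ᶠ n in atTop, c ≤ α n * (lam - k * α n))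
    (hβ : ∀ n, β n ∈ Set.Ioo (0 : ℝ) 1) (hβlim : Tendsto β atTop (𝓝 0))
    (hβsum : Tendsto (fun N => ∑ n ∈ Finset.range N, β n) atTop atTop)
    {u : E} (hu : u ∈ C) {x : ℕ → E} (hx0 : x 0 ∈ C)
    (hx : ∀ n, x (n + 1) = β n • u + (1 - β n) • (x n - α n • (x n - T (x n)))) :
    ∃ q ∈ C, T q = q ∧ Tendsto x atTop (𝓝 q) := by
  obtain ⟨q, hqC, hTq, hq⟩ :=
    exists_fixedPoint_near_resolvents hk0 hk hlam hT hC hCc hTC hp hTp hu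
  refine ⟨q, hqC, hTq, ?_⟩
  have hxC : ∀ n, x n ∈ C := by
    intro n
    induction n with
    | zero => exact hx0
    | succ n ih =>
      rw [hx n]
      exact hCc hu (relaxed_mem hCc hTC ih (hα n)) (hβ n).1.le (by linarith [(hβ n).2]) (by ring)
  obtain ⟨M, hM1, huM, hx0M⟩ : ∃ M : ℝ, 1 ≤ M ∧ ‖u - q‖ ≤ M ∧ ‖x 0 - q‖ ≤ M :=
    ⟨max 1 (max ‖u - q‖ ‖x 0 - q‖), le_max_left _ _,
      (le_max_left _ _).trans (le_max_right _ _), (le_max_right _ _).trans (le_max_right _ _)⟩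
  have hdecomp : ∀ n, x (n + 1) - q
      = (1 - β n) • (x n - α n • (x n - T (x n)) - q) + β n • (u - q) := by
    intro n
    rw [hx n, smul_sub (1 - β n) _ q, smul_sub (β n), sub_smul 1 (β n) q, one_smul]; abel
  have hy : ∀ n, ‖x n - α n • (x n - T (x n)) - q‖ ^ 2
      ≤ ‖x n - q‖ ^ 2 - 2 * (α n * (lam - k * α n)) * ‖x n - T (x n)‖ ^ 2 := by
    intro n
    have := norm_relaxed_sub_sq_le hk0.le hk hT (hxC n) hqC (hα n).1
    rwa [hTq, sub_self, smul_zero, sub_zero, sub_zero] at this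
  have hy' : ∀ n, ‖x n - α n • (x n - T (x n)) - q‖ ≤ ‖x n - q‖ := by
    intro n
    have := norm_relaxed_sub_le hk0.le hk hT (hxC n) hqC (hα n).1 (hkα n)
    rwa [hTq, sub_self, smul_zero, sub_zero] at this
  have hxM : ∀ n, ‖x n - q‖ ≤ M := by
    intro n
    induction n with
    | zero => exact hx0M
    | succ n ih =>
      have hb := (hβ n).1.le
      have hb' : 0 ≤ 1 - β n := by linarith [(hβ n).2]
      rw [hdecomp n]
      refine (norm_add_le _ _).trans ?_
      rw [norm_smul, norm_smul, Real.norm_of_nonneg hb, Real.norm_of_nonneg hb']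
      calc (1 - β n) * ‖x n - α n • (x n - T (x n)) - q‖ + β n * ‖u - q‖
          ≤ (1 - β n) * M + β n * M := by gcongr; exact (hy' n).trans ih
        _ = M := by ring
  have hstep : ∀ n, ‖x (n + 1) - x n‖ ≤ β n * (2 * M) + ‖x n - T (x n)‖ := by
    intro n
    have hb := (hβ n).1.le
    have hb' : 0 ≤ 1 - β n := by linarith [(hβ n).2]
    have e : x (n + 1) - x n
        = β n • (u - x n) - ((1 - β n) * α n) • (x n - T (x n)) := by
      rw [hx n, mul_smul, smul_sub (1 - β n) (x n), smul_sub (β n), sub_smul 1 (β n) (x n),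
        one_smul]
      abel
    rw [e]
    refine (norm_sub_le _ _).trans ?_
    rw [norm_smul, norm_smul, Real.norm_of_nonneg hb,
      Real.norm_of_nonneg (mul_nonneg hb' (hα n).1)]
    have h1 : ‖u - x n‖ ≤ 2 * M := by
      have := norm_sub_le_norm_sub_add_norm_sub u q (x n)
      rw [norm_sub_rev q] at this
      linarith [hxM n]
    have h2 : (1 - β n) * α n ≤ 1 := mul_le_one₀ (by linarith) (hα n).1 (hα n).2
    have h3 := mul_le_of_le_one_left (norm_nonneg (x n - T (x n))) h2
    gcongr
  have hmain : ∀ ε > 0, ∀ᶠ n in atTop, ‖x n - q‖ ^ 2 ≤ 2 * (2 * ε) := by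
    intro ε hε
    refine eventually_le_two_mul_of_recursion (by positivity) hβ hβsum ?_
    -- The total coefficient of ‖z - q‖ in the anchor bound is 8kM + M; this L makes its
    -- contribution at most ε/2.
    set L : ℝ := 2 * (8 * k * M + M) with hL
    have hM0 : 0 < M := by linarith
    obtain ⟨τ, hτ, z, hzC, hz, hzq⟩ := hq (min 1 (ε / L)) (by positivity)
    have hzq1 : ‖z - q‖ ≤ 1 := hzq.le.trans (min_le_left _ _)
    have hzqL : (8 * k * M + M) * ‖z - q‖ ≤ ε / 2 := by
      have := (le_div_iff₀ (by positivity)).1 (hzq.le.trans (min_le_right _ _))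
      rw [hL] at this
      linarith
    set P : ℝ := 2 * M / τ + 8 * k * M with hP
    set Q : ℝ := 16 * k * M ^ 2 with hQ
    have hβPQ : ∀ᶠ n in atTop, β n * (P ^ 2 / c + 2 * Q) < ε := by
      have : Tendsto (fun n => β n * (P ^ 2 / c + 2 * Q)) atTop (𝓝 0) := by
        simpa using hβlim.mul_const (P ^ 2 / c + 2 * Q)
      exact this.eventually_lt_const hε
    filter_upwards [hαc, hβPQ, hβlim.eventually_lt_const (half_pos one_pos)] with n h1 h2 h3
    obtain ⟨j, hj⟩ := normalizedDuality_nonempty (x (n + 1) - q)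
    set r := ‖x n - T (x n)‖ with hr
    have hr0 : 0 ≤ r := norm_nonneg _
    have hb := (hβ n).1.le
    have hj1 : j (u - q) ≤ P * r + Q * β n + ε / 2 := by
      have hxz : ‖x n - z‖ ≤ 2 * M := by
        have := norm_sub_le_norm_sub_add_norm_sub (x n) q z
        rw [norm_sub_rev q] at this
        linarith [hxM n]
      have huz : ‖u - z‖ ≤ 2 * M := by
        have := norm_sub_le_norm_sub_add_norm_sub u q z
        rw [norm_sub_rev q] at this
        linarith
      calc j (u - q) ≤ ‖x n - z‖ * r / τ
            + 4 * k * (‖x (n + 1) - x n‖ + ‖z - q‖) * ‖u - z‖ + ‖x (n + 1) - q‖ * ‖z - q‖ :=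
            normalizedDuality_anchor_le hk0.le hk hlam.le hT (hxC n) hzC hτ hz hj
        _ ≤ 2 * M * r / τ
            + 4 * k * (β n * (2 * M) + r + ‖z - q‖) * (2 * M) + M * ‖z - q‖ := by
            gcongr
            · exact hstep n
            · exact hxM _
        _ = P * r + Q * β n + (8 * k * M + M) * ‖z - q‖ := by rw [hP, hQ]; ring
        _ ≤ P * r + Q * β n + ε / 2 := by gcongr
    have hsub := normalizedDuality_subgradient hj
      ((1 - β n) • (x n - α n • (x n - T (x n)) - q))
    have e : (1 - β n) • (x n - α n • (x n - T (x n)) - q) - (x (n + 1) - q)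
        = -(β n • (u - q)) := by rw [hdecomp n]; abel
    rw [e, map_neg, map_smul, smul_eq_mul, norm_smul, mul_pow, Real.norm_eq_abs, sq_abs] at hsub
    have hsq : (1 - β n) ^ 2 * ‖x n - α n • (x n - T (x n)) - q‖ ^ 2
        ≤ (1 - β n) * (‖x n - q‖ ^ 2 - 2 * c * r ^ 2) := by
      have h4 : (1 - β n) ^ 2 ≤ 1 - β n := by nlinarith
      have h5 : c * r ^ 2 ≤ α n * (lam - k * α n) * r ^ 2 := by gcongr
      have h6 : (0 : ℝ) ≤ 1 - β n := by linarith
      calc _ ≤ (1 - β n) * ‖x n - α n • (x n - T (x n)) - q‖ ^ 2 := by gcongr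
        _ ≤ _ := by gcongr; linarith [hy n]
    have hcr : c * r ^ 2 ≤ (1 - β n) * (2 * c * r ^ 2) := by
      have : 0 ≤ c * r ^ 2 := by positivity
      nlinarith
    -- The part c r² of the gain that survives for β_n < 1/2 pays for the cross term.
    have hamgm : 2 * β n * (P * r) ≤ c * r ^ 2 + β n ^ 2 * (P ^ 2 / c) := by
      have h4 : 0 ≤ (c * r - β n * P) ^ 2 / c := by positivity
      have h5 : (c * r - β n * P) ^ 2 / c
          = c * r ^ 2 - 2 * β n * (P * r) + β n ^ 2 * (P ^ 2 / c) := by field_simp; ring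
      linarith
    have hj2 := mul_le_mul_of_nonneg_left hj1 hb
    have h2' := mul_le_mul_of_nonneg_left h2.le hb
    nlinarith
  rw [tendsto_iff_norm_sub_tendsto_zero]
  refine (Metric.tendsto_nhds.2 fun δ hδ => ?_)
  filter_upwards [hmain (δ ^ 2 / 8) (by positivity)] with n hn
  rw [Real.dist_eq, sub_zero, abs_norm]
  have : 0 < δ ^ 2 := by positivity
  exact lt_of_pow_lt_pow_left₀ 2 hδ.le (by linarith)

end Halpern

theorem corollary3p2 {E : Type*} [NormedAddCommGroup E] [NormedSpace ℝ E] [CompleteSpace E]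
    (hE : IsQUniformlySmooth E 2)
    (C : Set E) (hCclosed : IsClosed C) (hCconvex : Convex ℝ C)
    (T : E → E) (hTC : Set.MapsTo T C C)
    (lam : ℝ) (hlam : lam ∈ Set.Ioo (0 : ℝ) 1)
    (hT : IsStrictPseudocontractionOn lam T C)
    (hF : (C ∩ Function.fixedPoints T).Nonempty)
    (α β : ℕ → ℝ)
    (hα : ∀ n, α n ∈ Set.Icc 0 (min 1 (lam / bestSmoothConst E ^ 2)))
    (hαliminf : 0 < liminf (fun n => α n * (lam - bestSmoothConst E ^ 2 * α n)) atTop)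
    (hβ : ∀ n, β n ∈ Set.Ioo (0 : ℝ) 1)
    (hβlim : Tendsto β atTop (𝓝 0))
    (hβsum : Tendsto (fun N => ∑ n ∈ Finset.range N, β n) atTop atTop)
    (u : E) (hu : u ∈ C) (x : ℕ → E) (hx0 : x 0 ∈ C)
    (hx : ∀ n, x (n + 1) = β n • u + (1 - β n) • (α n • T (x n) + (1 - α n) • x n)) :
    ∃ z ∈ C ∩ Function.fixedPoints T, Tendsto x atTop (𝓝 z) := by
  -- In the zero space K = 0 and `lam / K ^ 2` is 0 by convention; positivity of K² needs a nonzero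
  -- vector.
  rcases subsingleton_or_nontrivial E with hs | hs
  · obtain ⟨p, hp⟩ := hF
    refine ⟨p, hp, ?_⟩
    rw [show x = fun _ => p from funext fun n => Subsingleton.elim _ _]
    exact tendsto_const_nhds
  have hk0 := bestSmoothConst_sq_pos hE
  have hkα : ∀ n, bestSmoothConst E ^ 2 * α n ≤ lam := fun n => by
    have := (le_div_iff₀ hk0).1 ((hα n).2.trans (min_le_right _ _))
    linarith
  obtain ⟨c, hc, hcα⟩ := exists_between hαliminf
  -- A real `liminf` yields eventual lower bounds only once the sequence is known to be bounded
  -- below.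
  have hbdd : IsBoundedUnder (· ≥ ·) atTop
      fun n => α n * (lam - bestSmoothConst E ^ 2 * α n) :=
    isBoundedUnder_of ⟨0, fun n => mul_nonneg (hα n).1 (sub_nonneg.2 (hkα n))⟩
  obtain ⟨p, hpC, hTp⟩ := hF
  obtain ⟨q, hqC, hTq, hxq⟩ := halpern_tendsto hk0 (fun x y j hj => bestSmoothConst_spec hE x y hj)
    hlam.1 hT hCclosed hCconvex hTC hpC hTp
    (fun n => ⟨(hα n).1, (hα n).2.trans (min_le_left _ _)⟩) hkα hc
    ((eventually_lt_of_lt_liminf hcα hbdd).mono fun n hn => hn.le) hβ hβlim hβsum hu hx0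
    (fun n => by rw [hx n, smul_sub (α n), sub_smul 1 (α n), one_smul]; congr 2; abel)
  exact ⟨q, ⟨hqC, hTq⟩, hxq⟩
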